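/- Let $d\ge 1$, let $v\in\mathbb{R}^d$, and let $w_1,\dots,w_n\in\mathbb{R}^d$ ($n\ge d$) be nonzero vectors such that the polyhedral cone $K=\{v+\sum_{i=1}^n t_iw_i : t_1,\dots,t_n\ge 0\}$ with apex $v$ contains no line. For $x\in\mathbb{R}^d$ and $\xi\in\mathbb{C}^d$ put $\langle x,\xi\rangle=\sum_k x_k\xi_k$, and set $$\hat 1_K(\xi)=(2\pi i)^d\int_K e^{-2\pi i\langle x,\xi\rangle}\,dx ,$$ the (normalized) Fourier transform of the indicator function of $K$. The integral converges absolutely for every $\xi\in\mathbb{C}^d$ such that $\operatorname{Im}\langle w_i,\xi\rangle<0$ for all $i$, and there is a unique real polynomial $p_K$ in $d$ variables such that $$\hat 1_K(\xi)=\frac{p_K(\xi)}{\prod_{i=1}^n\langle w_i,\xi\rangle}\;e^{-2\pi i\langle v,\xi\rangle}$$ for all these $\xi$. It is homogeneous of degree $n-d$. For $x_1,\dots,x_{d-1}\in\mathbb{R}^d$, the generalized cross product $[x_1,\dots,x_{d-1}]$ is the unique vector in $\mathbb{R}^d$ with $\langle[x_1,\dots,x_{d-1}],x\rangle=\det(x_1,\dots,x_{d-1},x)$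 for all $x\in\mathbb{R}^d$. Let $i_1,\dots,i_{d-1}\in\{1,\dots,n\}$ be distinct indices, and put $D=(w_{i_1},\dots,w_{i_{d-1}})$ (a diagonal of $K$), $D^*=[w_{i_1},\dots,w_{i_{d-1}}]$ and $\det(D,x)=\det(w_{i_1},\dots,w_{i_{d-1}},x)$. Call $D$ extremal if the cone $\{v+\sum_{k=1}^{d-1}t_kw_{i_k}: t_k\ge 0\}$ is contained in the topological boundary $\partial K$, and interior otherwise. (i) If $D$ is extremal, then all the nonzero ones among the determinants $\det(D,w_j)$, $j\notin\{i_1,\dots,i_{d-1}\}$, have the same sign, and $$p_K(D^*)=\varepsilon\prod_{j\notin\{i_1,\dots,i_{d-1}\}}\det(D,w_j),$$ where $\varepsilon\in\{1,-1\}$ is this common sign (if all these determinants vanish, either value of $\varepsilon$ may be taken). (ii) If $D$ is interior, then $p_K(D^*)=0$. -/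

import Mathlib

open MeasureTheory

noncomputable section

namespace ConicFourier

/-- The polyhedral cone with apex `v` generated by the vectors `w i`. -/
def polyCone {d : ℕ} {ι : Type} [Fintype ι] (v : EuclideanSpace ℝ (Fin d))
    (w : ι → EuclideanSpace ℝ (Fin d)) : Set (EuclideanSpace ℝ (Fin d)) :=
  {x | ∃ t : ι → ℝ, (∀ i, 0 ≤ t i) ∧ x = v + ∑ i, t i • w i}

/-- The set `S` contains no (affine) line. -/
def ContainsNoLine {d : ℕ} (S : Set (EuclideanSpace ℝ (Fin d))) : Prop :=
  ∀ x u : EuclideanSpace ℝ (Fin d), (∀ t : ℝ, x + t • u ∈ S) → u = 0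

/-- The complex bilinear extension of the standard inner product:
`⟨x, ξ⟩ = ∑ k, x k * ξ k` for `x` real and `ξ` complex. -/
def pairing {d : ℕ} (x : EuclideanSpace ℝ (Fin d)) (ξ : Fin d → ℂ) : ℂ :=
  ∑ k, (x k : ℂ) * ξ k

/-- The Fourier kernel `exp (-2πi⟨x, ξ⟩)`. -/
def fourierKernel {d : ℕ} (ξ : Fin d → ℂ) (x : EuclideanSpace ℝ (Fin d)) : ℂ :=
  Complex.exp (-(2 * Real.pi * Complex.I) * pairing x ξ)

/-- The Fourier transform of the indicator function of `S` at a complex frequency `ξ`. -/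
def indicatorFourier {d : ℕ} (S : Set (EuclideanSpace ℝ (Fin d))) (ξ : Fin d → ℂ) : ℂ :=
  ∫ x in S, fourierKernel ξ x

/-- The complex frequencies at which the Fourier integral over a cone with generators `w i`
converges absolutely: the kernel decays along every generator. -/
def convergenceDomain {d n : ℕ} (w : Fin n → EuclideanSpace ℝ (Fin d)) : Set (Fin d → ℂ) :=
  {ξ | ∀ i, (pairing (w i) ξ).im < 0}

/-- `p` is the numerator of the Fourier transform of the cone with apex `v` and generators `w i`:
`(2πi)^d * 1̂_K(ξ) = p(ξ) / ∏ i, ⟨w i, ξ⟩ * exp (-2πi⟨v, ξ⟩)`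
wherever the Fourier integral converges. -/
def IsFourierNumerator {d n : ℕ} (v : EuclideanSpace ℝ (Fin d))
    (w : Fin n → EuclideanSpace ℝ (Fin d)) (p : MvPolynomial (Fin d) ℝ) : Prop :=
  ∀ ξ ∈ convergenceDomain w,
    (2 * Real.pi * Complex.I) ^ d * indicatorFourier (polyCone v w) ξ =
      MvPolynomial.aeval ξ p / (∏ i, pairing (w i) ξ) * fourierKernel ξ v

/-- `det (x₁, …, x_{d-1}, x)` in dimension `d = m + 1`, the vectors being the columns. -/
def detLast {m : ℕ} (xs : Fin m → EuclideanSpace ℝ (Fin (m + 1)))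
    (x : EuclideanSpace ℝ (Fin (m + 1))) : ℝ :=
  Matrix.det (Matrix.of fun k l : Fin (m + 1) =>
    (Fin.snoc xs x : Fin (m + 1) → EuclideanSpace ℝ (Fin (m + 1))) l k)

theorem detLast_eq_updateCol {m : ℕ} (xs : Fin m → EuclideanSpace ℝ (Fin (m + 1)))
    (x : EuclideanSpace ℝ (Fin (m + 1))) :
    detLast xs x = Matrix.det (Matrix.updateCol (Matrix.of fun k l : Fin (m + 1) =>
      (Fin.snoc xs 0 : Fin (m + 1) → EuclideanSpace ℝ (Fin (m + 1))) l k)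
        (Fin.last m) (fun k => x k)) := by
  unfold detLast
  congr 1
  ext k l
  refine Fin.lastCases ?_ (fun l => ?_) l
  · simp
  · simp [Matrix.updateCol_apply, (Fin.castSucc_lt_last l).ne]

/-- The linear functional `x ↦ det (x₁, …, x_{d-1}, x)`. -/
def detLastLinear {m : ℕ} (xs : Fin m → EuclideanSpace ℝ (Fin (m + 1))) :
    EuclideanSpace ℝ (Fin (m + 1)) →ₗ[ℝ] ℝ where
  toFun := detLast xs
  map_add' x y := by
    simp only [detLast_eq_updateCol]
    exact Matrix.det_updateCol_add _ _ _ _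
  map_smul' c x := by
    simp only [detLast_eq_updateCol]
    exact Matrix.det_updateCol_smul _ _ _ _

/-- The generalized cross product `[x₁, …, x_{d-1}]`: the vector that represents the functional
`x ↦ det (x₁, …, x_{d-1}, x)` through the standard inner product. -/
def genCross {m : ℕ} (xs : Fin m → EuclideanSpace ℝ (Fin (m + 1))) :
    EuclideanSpace ℝ (Fin (m + 1)) :=
  (InnerProductSpace.toDual ℝ (EuclideanSpace ℝ (Fin (m + 1)))).symm
    (LinearMap.toContinuousLinearMap (detLastLinear xs))

theorem inner_genCross {m : ℕ} (xs : Fin m → EuclideanSpace ℝ (Fin (m + 1)))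
    (x : EuclideanSpace ℝ (Fin (m + 1))) :
    inner ℝ (genCross xs) x = detLast xs x := by
  simp [genCross, detLastLinear]

/-- A diagonal, that is a choice `D` of `d - 1` of the generators listed in some order,
is extremal if the cone it spans lies in the boundary of the whole cone. -/
def IsExtremal {d m n : ℕ} (v : EuclideanSpace ℝ (Fin d))
    (w : Fin n → EuclideanSpace ℝ (Fin d)) (D : Fin m ↪ Fin n) : Prop :=
  polyCone v (fun k => w (D k)) ⊆ frontier (polyCone v w)

end ConicFourier

end

open ConicFourier

noncomputable section

namespace ConicFourier

/-! ### Linear programming and regular triangulations. -/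

section Cells

variable {ι : Type} {E : Type*} [NormedAddCommGroup E] [InnerProductSpace ℝ E]

/-! Assign generic heights `c i` to the generators and minimize `∑ t i * c i` over the nonnegative
representations `x - v = ∑ t i • w i`. Off finitely many proper affine subspaces, the optimal
support is a basis whose dual solution `y` is tight exactly there. These supports are the cells of a
triangulation of the cone up to a null set (`polyCone_ae_eq_iUnion_cells`). Each simplicial cell
contributes its absolute determinant divided by the product of its linear forms, so `p = ∑ σ, absDet
w σ * ∏ j ∉ σ, ⟨w j, ξ⟩` (`isFourierNumerator_coneNumerator`), and `p` is unique.

Write `δ j = det (D, w j)`. At `D*` the form of `w j` takes the value `δ j`, which vanishes on `D`.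
Only the cells `D ∪ {j}` survive, and each contributes `sign (δ j) * ∏ k ∉ D, δ k`
(`eval_genCross_coneNumerator`). If some `δ k` with `k ∉ D` is zero, everything vanishes. Otherwise
the dual points tight on `D` form a line in direction `D*`. On it the remaining constraints cut out
an interval, whose endpoints are the cells containing `D`. With all `δ` of one sign the interval is
a half-line, giving one endpoint and that sign. With both signs it is empty or has two endpoints of
opposite sign, giving zero. Mixed signs make `D` interior and a common sign makes it extremal
(`IsExtremal.not_pos_neg`, `isExtremal_of_forall_nonneg`). -/

/-- The cells of the regular triangulation of a cone with generators `w` and heights `c`. -/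
def IsCell (w : ι → E) (c : ι → ℝ) (σ : Finset ι) : Prop :=
  LinearIndepOn ℝ w (σ : Set ι) ∧ Submodule.span ℝ (w '' (σ : Set ι)) = ⊤ ∧
    ∃ y : E, (∀ i ∈ σ, inner ℝ (w i) y = c i) ∧ ∀ j ∉ σ, inner ℝ (w j) y < c j

/-- Weak duality: `z` is dual feasible, while `y` is tight on `σ` and so attains the cost of `t`.
The gap is strict as soon as some index of `σ` is slack for `z`. -/
theorem inner_le_of_mem_cells {w : ι → E} {c : ι → ℝ} {σ τ : Finset ι} {y z : E}
    (hy : ∀ i ∈ σ, inner ℝ (w i) y = c i)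
    (hz : ∀ i ∈ τ, inner ℝ (w i) z = c i) (hz' : ∀ j ∉ τ, inner ℝ (w j) z < c j)
    {t : ι → ℝ} (ht : ∀ i ∈ σ, 0 < t i) :
    inner ℝ (∑ i ∈ σ, t i • w i) z ≤ inner ℝ (∑ i ∈ σ, t i • w i) y ∧
      (¬ σ ⊆ τ → inner ℝ (∑ i ∈ σ, t i • w i) z < inner ℝ (∑ i ∈ σ, t i • w i) y) := by
  classical
  have key : ∀ i, inner ℝ (w i) z ≤ c i := fun i =>
    if h : i ∈ τ then (hz i h).le else (hz' i h).le
  simp only [sum_inner, real_inner_smul_left]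
  constructor
  · exact Finset.sum_le_sum fun i hi =>
      mul_le_mul_of_nonneg_left ((key i).trans (hy i hi).ge) (ht i hi).le
  · intro h
    obtain ⟨j, hjσ, hjτ⟩ := Finset.not_subset.1 h
    refine Finset.sum_lt_sum (fun i hi =>
      mul_le_mul_of_nonneg_left ((key i).trans (hy i hi).ge) (ht i hi).le) ⟨j, hjσ, ?_⟩
    exact mul_lt_mul_of_pos_left ((hz' j hjτ).trans_eq (hy j hjσ).symm) (ht j hjσ)

theorem IsCell.eq_of_sum_eq {w : ι → E} {c : ι → ℝ} {σ τ : Finset ι} (hσ : IsCell w c σ)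
    (hτ : IsCell w c τ) {t s : ι → ℝ} (ht : ∀ i ∈ σ, 0 < t i) (hs : ∀ i ∈ τ, 0 < s i)
    (h : ∑ i ∈ σ, t i • w i = ∑ i ∈ τ, s i • w i) : σ = τ := by
  obtain ⟨-, -, y, hy, hy'⟩ := hσ
  obtain ⟨-, -, z, hz, hz'⟩ := hτ
  obtain ⟨h1, h1'⟩ := inner_le_of_mem_cells hy hz hz' ht
  obtain ⟨h2, h2'⟩ := inner_le_of_mem_cells hz hy hy' hs
  rw [h] at h1 h1'
  refine Finset.Subset.antisymm ?_ ?_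
  · by_contra hn
    exact absurd (h1' hn) h2.not_gt
  · by_contra hn
    exact absurd (h2' hn) h1.not_gt

theorem exists_inner_eq_of_linearIndepOn [FiniteDimensional ℝ E] {w : ι → E} {σ : Finset ι}
    (hσ : LinearIndepOn ℝ w (σ : Set ι)) (c : ι → ℝ) :
    ∃ y : E, ∀ i ∈ σ, inner ℝ (w i) y = c i := by
  have : CompleteSpace E := FiniteDimensional.complete ℝ E
  let b := Module.Basis.span hσ
  obtain ⟨f, hf⟩ := (b.constr ℝ fun i => c i).exists_extend
  refine ⟨(InnerProductSpace.toDual ℝ E).symm (LinearMap.toContinuousLinearMap f), fun i hi => ?_⟩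
  rw [real_inner_comm, InnerProductSpace.toDual_symm_apply]
  have h := b.constr_basis ℝ (fun i => c i) ⟨i, hi⟩
  rw [← hf, LinearMap.comp_apply, Submodule.subtype_apply] at h
  have h' : ((Module.Basis.span hσ ⟨i, hi⟩ : Submodule.span ℝ _) : E) = w i :=
    congrArg Subtype.val (Module.Basis.span_apply hσ ⟨i, hi⟩)
  rwa [h'] at h

variable [Fintype ι]

/-- The heights `c` are generic for the vectors `w`: no lifted vector `(w j, c j)` lies in the span
of lifted vectors whose projections are linearly independent. -/
def IsGeneric (w : ι → E) (c : ι → ℝ) : Prop :=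
  ∀ σ : Finset ι, LinearIndepOn ℝ w (σ : Set ι) → ∀ j ∉ σ, ∀ a : ι → ℝ, (∀ i ∉ σ, a i = 0) →
    ∑ i, a i • w i = w j → ∑ i, a i * c i ≠ c j

theorem coeff_unique_of_linearIndepOn {w : ι → E} {σ : Finset ι}
    (hσ : LinearIndepOn ℝ w (σ : Set ι)) {a b : ι → ℝ} (ha : ∀ i ∉ σ, a i = 0)
    (hb : ∀ i ∉ σ, b i = 0) (h : ∑ i, a i • w i = ∑ i, b i • w i) : a = b := by
  have h0 : ∑ i ∈ σ, (a i - b i) • w i = 0 := by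
    rw [Finset.sum_subset (Finset.subset_univ σ)
      (fun i _ hi => by rw [ha i hi, hb i hi]; simp)]
    simp only [sub_smul, Finset.sum_sub_distrib, h, sub_self]
  have h1 := linearIndepOn_finset_iff.1 hσ _ h0
  funext i
  by_cases hi : i ∈ σ
  · exact sub_eq_zero.1 (h1 i hi)
  · rw [ha i hi, hb i hi]

/-- Each pair `(σ, j)` excludes one hyperplane of heights, the kernel of evaluation at `e_j - a`.
Some functional is nonzero on these finitely many nonzero vectors. -/
theorem exists_isGeneric (w : ι → E) : ∃ c : ι → ℝ, IsGeneric w c := by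
  classical
  let P : Finset ι × ι → (ι → ℝ) → Prop := fun p a =>
    p.2 ∉ p.1 ∧ (∀ i ∉ p.1, a i = 0) ∧ ∑ i, a i • w i = w p.2
  let u : Finset ι × ι → ι → ℝ := fun p =>
    if h : ∃ a, P p a then Pi.single p.2 1 - h.choose else Pi.single p.2 1
  have hu : ∀ p, u p ≠ 0 := by
    intro p hp
    have h1 : u p p.2 = 1 := by
      by_cases h : ∃ a, P p a
      · simp only [u, dif_pos h, Pi.sub_apply, Pi.single_eq_same]
        rw [h.choose_spec.2.1 _ h.choose_spec.1, sub_zero]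
      · simp only [u, dif_neg h, Pi.single_eq_same]
    rw [hp] at h1
    simp at h1
  obtain ⟨f, hf⟩ := Module.exists_dual_forall_apply_ne_zero (K := ℝ) u hu
  refine ⟨fun i => f (Pi.single i 1), fun σ hσ j hj a ha haw hc => hf (σ, j) ?_⟩
  have h : ∃ a, P (σ, j) a := ⟨a, hj, ha, haw⟩
  -- Independence on `σ` makes the coefficients unique, so the arbitrary choice in `u` is harmless.
  have h2 : h.choose = a := coeff_unique_of_linearIndepOn hσ h.choose_spec.2.1 ha
    (h.choose_spec.2.2.trans haw.symm)
  simp only [u, dif_pos h, h2, map_sub]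
  have h3 : f a = ∑ i, a i * f (Pi.single i 1) := by
    conv_lhs => rw [← Finset.univ_sum_single a, map_sum]
    refine Finset.sum_congr rfl fun i _ => ?_
    rw [← smul_eq_mul, ← map_smul, ← Pi.single_smul, smul_eq_mul, mul_one]
  rw [h3, hc, sub_self]

/-- Pairing with `l` bounds every coefficient, so the feasible set is compact. -/
theorem exists_optimal (w : ι → E) (c : ι → ℝ) {l : E} (hl : ∀ i, 0 < inner ℝ (w i) l)
    {t₀ : ι → ℝ} (ht₀ : ∀ i, 0 ≤ t₀ i) :
    ∃ t : ι → ℝ, (∀ i, 0 ≤ t i) ∧ ∑ i, t i • w i = ∑ i, t₀ i • w i ∧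
      ∀ s : ι → ℝ, (∀ i, 0 ≤ s i) → ∑ i, s i • w i = ∑ i, t₀ i • w i →
        ∑ i, t i * c i ≤ ∑ i, s i * c i := by
  set x := ∑ i, t₀ i • w i with hx
  let S : Set (ι → ℝ) := {t | (∀ i, 0 ≤ t i) ∧ ∑ i, t i • w i = x}
  have hclosed : IsClosed S := by
    have h1 : IsClosed {t : ι → ℝ | ∀ i, 0 ≤ t i} := by
      simp only [Set.ofPred_forall]
      exact isClosed_iInter fun i => isClosed_le continuous_const (continuous_apply i)
    have h2 : IsClosed {t : ι → ℝ | ∑ i, t i • w i = x} :=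
      isClosed_eq (by fun_prop) continuous_const
    exact h1.inter h2
  have hsub : S ⊆ Set.Icc 0 (fun i => inner ℝ x l / inner ℝ (w i) l) := by
    rintro t ⟨ht, htx⟩
    refine ⟨ht, fun i => ?_⟩
    rw [le_div_iff₀ (hl i), ← htx, sum_inner]
    simp only [real_inner_smul_left]
    exact Finset.single_le_sum (f := fun i => t i * inner ℝ (w i) l)
      (fun j _ => mul_nonneg (ht j) (hl j).le) (Finset.mem_univ i)
  have hcomp : IsCompact S := isCompact_Icc.of_isClosed_subset hclosed hsub
  obtain ⟨t, ht, hmin⟩ := hcomp.exists_isMinOn ⟨t₀, ht₀, rfl⟩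
    (f := fun t => ∑ i, t i * c i) (by fun_prop)
  exact ⟨t, ht.1, ht.2, fun s hs hsx => hmin ⟨hs, hsx⟩⟩

/-- A short step from `t` along `u` stays feasible, and optimality forbids a decrease in cost. -/
theorem cost_nonneg_of_optimal {w : ι → E} {c t : ι → ℝ} (ht : ∀ i, 0 ≤ t i)
    (hopt : ∀ s : ι → ℝ, (∀ i, 0 ≤ s i) → ∑ i, s i • w i = ∑ i, t i • w i →
        ∑ i, t i * c i ≤ ∑ i, s i * c i)
    {u : ι → ℝ} (hu : ∑ i, u i • w i = 0) (hu' : ∀ i, t i = 0 → 0 ≤ u i) :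
    0 ≤ ∑ i, u i * c i := by
  have h : ∀ᶠ δ : ℝ in nhdsWithin 0 (Set.Ioi 0), ∀ i, 0 ≤ t i + δ * u i := by
    refine Filter.eventually_all.2 fun i => ?_
    rcases (ht i).eq_or_lt with h0 | h0
    · filter_upwards [self_mem_nhdsWithin] with δ hδ
      rw [← h0, zero_add]
      exact mul_nonneg (le_of_lt hδ) (hu' i h0.symm)
    · have hc : Continuous fun δ : ℝ => t i + δ * u i := by fun_prop
      have h1 : ∀ᶠ δ : ℝ in nhds 0, 0 < t i + δ * u i :=
        hc.continuousAt.eventually (lt_mem_nhds (by simpa using h0))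
      filter_upwards [nhdsWithin_le_nhds h1] with δ hδ using hδ.le
  obtain ⟨δ, hδ, hδ0⟩ := (h.and self_mem_nhdsWithin).exists
  have h2 := hopt (fun i => t i + δ * u i) hδ (by
    simp only [add_smul, Finset.sum_add_distrib, mul_smul, ← Finset.smul_sum, hu, smul_zero,
      add_zero])
  simp only [add_mul, Finset.sum_add_distrib, mul_assoc, ← Finset.mul_sum] at h2
  exact nonneg_of_mul_nonneg_right (by linarith) hδ0

theorem exists_coeff_of_mem_span_image {w : ι → E} {σ : Finset ι} {x : E}
    (hx : x ∈ Submodule.span ℝ (w '' (σ : Set ι))) :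
    ∃ a : ι → ℝ, (∀ i ∉ σ, a i = 0) ∧ ∑ i, a i • w i = x := by
  classical
  obtain ⟨a, ha⟩ := (Submodule.mem_span_image_finset_iff_exists_fun ℝ).1 hx
  refine ⟨fun i => if h : i ∈ σ then a ⟨i, h⟩ else 0, fun i hi => dif_neg hi, ?_⟩
  rw [← ha, ← Finset.sum_subset (Finset.subset_univ σ) (fun i _ hi => by simp [hi]),
    ← Finset.sum_attach]
  exact Finset.sum_congr rfl fun i _ => by simp

/-- A generic linear program has optimal solutions with linearly independent support, and all
reduced costs outside the support are positive. -/
theorem linearIndepOn_support_of_optimal {w : ι → E} {c t : ι → ℝ} (hc : IsGeneric w c)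
    (ht : ∀ i, 0 ≤ t i)
    (hopt : ∀ s : ι → ℝ, (∀ i, 0 ≤ s i) → ∑ i, s i • w i = ∑ i, t i • w i →
        ∑ i, t i * c i ≤ ∑ i, s i * c i)
    {σ : Finset ι} (hσ : ∀ i, i ∈ σ ↔ 0 < t i) :
    LinearIndepOn ℝ w (σ : Set ι) ∧ ∀ j ∉ σ, ∀ a : ι → ℝ, (∀ i ∉ σ, a i = 0) →
      ∑ i, a i • w i = w j → ∑ i, a i * c i < c j := by
  classical
  have hne : ∀ i ∈ σ, t i ≠ 0 := fun i hi => ((hσ i).1 hi).ne'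
  have hind : LinearIndepOn ℝ w (σ : Set ι) := by
    obtain ⟨b, hbσ, -, hspan, hb⟩ := exists_linearIndepOn_extension
      (linearIndepOn_empty ℝ w) (Set.empty_subset (σ : Set ι))
    lift b to Finset ι using b.toFinite
    rw [Finset.coe_subset] at hbσ
    -- Here `b` is a maximal independent subset of the support. An index of the support outside `b`
    -- gives a relation supported in `σ`, usable in both directions. Its cost is then zero, against
    -- genericity at `b`.
    by_cases hEq : σ ⊆ b
    · rwa [Finset.Subset.antisymm hEq hbσ]
    · exfalso
      obtain ⟨j, hjσ, hjb⟩ := Finset.not_subset.1 hEq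
      obtain ⟨a, ha, haw⟩ := exists_coeff_of_mem_span_image
        (hspan ⟨j, hjσ, rfl⟩)
      have h0 : ∀ i, t i = 0 → (Pi.single j 1 - a : ι → ℝ) i = 0 := by
        intro i hi
        have hij : i ≠ j := fun h => hne j hjσ (h ▸ hi)
        have hib : i ∉ b := fun h => hne i (hbσ h) hi
        simp [hij, ha i hib]
      have hs : ∑ i, (Pi.single j 1 - a : ι → ℝ) i • w i = 0 := by
        simp [sub_smul, Finset.sum_sub_distrib, haw, Pi.single_apply]
      have h1 := cost_nonneg_of_optimal ht hopt hs (fun i hi => (h0 i hi).ge)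
      have h2 := cost_nonneg_of_optimal ht hopt (u := -(Pi.single j 1 - a))
        (by simpa only [Pi.neg_apply, neg_smul, Finset.sum_neg_distrib, neg_eq_zero] using hs)
        (fun i hi => by rw [Pi.neg_apply, h0 i hi, neg_zero])
      have h3 : ∑ i, (Pi.single j 1 - a : ι → ℝ) i * c i = c j - ∑ i, a i * c i := by
        simp [sub_mul, Finset.sum_sub_distrib, Pi.single_apply]
      simp only [Pi.neg_apply, neg_mul, Finset.sum_neg_distrib] at h2
      exact hc b hb j hjb a ha haw (by linarith)
  refine ⟨hind, fun j hj a ha haw => lt_of_le_of_ne ?_ (hc σ hind j hj a ha haw)⟩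
  -- Letting `j` enter the support is allowed in the positive direction only, which gives the
  -- reduced cost a sign; genericity makes it strict.
  have h1 := cost_nonneg_of_optimal ht hopt (u := Pi.single j 1 - a)
    (by simp [sub_smul, Finset.sum_sub_distrib, haw, Pi.single_apply])
    (fun i hi => by
      have hiσ : i ∉ σ := fun h => hne i h hi
      rw [Pi.sub_apply, ha i hiσ, sub_zero, Pi.single_apply]
      split_ifs <;> norm_num)
  have h3 : ∑ i, (Pi.single j 1 - a : ι → ℝ) i * c i = c j - ∑ i, a i * c i := by
    simp [sub_mul, Finset.sum_sub_distrib, Pi.single_apply]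
  linarith

/-- By `hx` the optimal support spans. The dual point `y` solves the tight equations, and positivity
of the reduced costs is exactly slackness of the other constraints at `y`. -/
theorem exists_cell_of_generic [FiniteDimensional ℝ E] {w : ι → E} {c : ι → ℝ}
    (hc : IsGeneric w c) {l : E} (hl : ∀ i, 0 < inner ℝ (w i) l)
    {t₀ : ι → ℝ} (ht₀ : ∀ i, 0 ≤ t₀ i)
    (hx : ∀ σ : Finset ι, ∑ i, t₀ i • w i ∈ Submodule.span ℝ (w '' (σ : Set ι)) →
      Submodule.span ℝ (w '' (σ : Set ι)) = ⊤) :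
    ∃ σ, IsCell w c σ ∧ ∃ t : ι → ℝ, (∀ i ∈ σ, 0 < t i) ∧
      ∑ i ∈ σ, t i • w i = ∑ i, t₀ i • w i := by
  classical
  obtain ⟨t, ht, htx, hopt⟩ := exists_optimal w c hl ht₀
  let σ : Finset ι := Finset.univ.filter fun i => 0 < t i
  have hσ : ∀ i, i ∈ σ ↔ 0 < t i := fun i => by simp [σ]
  obtain ⟨hind, hred⟩ := linearIndepOn_support_of_optimal hc ht (by rwa [htx]) hσ
  have hsum : ∑ i ∈ σ, t i • w i = ∑ i, t₀ i • w i := by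
    rw [← htx]
    refine Finset.sum_subset (Finset.subset_univ σ) fun i _ hi => ?_
    rw [le_antisymm (not_lt.1 fun h => hi ((hσ i).2 h)) (ht i), zero_smul]
  have hspan := hx σ (by
    rw [← hsum]
    exact Submodule.sum_mem _ fun i hi =>
      Submodule.smul_mem _ _ (Submodule.subset_span ⟨i, hi, rfl⟩))
  obtain ⟨y, hy⟩ := exists_inner_eq_of_linearIndepOn hind c
  refine ⟨σ, ⟨hind, hspan, y, hy, fun j hj => ?_⟩, t, fun i hi => (hσ i).1 hi, hsum⟩
  obtain ⟨a, ha, haw⟩ := exists_coeff_of_mem_span_image (w := w) (σ := σ) (x := w j)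
    (hspan ▸ Submodule.mem_top)
  have h := hred j hj a ha haw
  rw [← haw, sum_inner]
  refine lt_of_eq_of_lt (Finset.sum_congr rfl fun i _ => ?_) h
  rw [real_inner_smul_left]
  by_cases hi : i ∈ σ
  · rw [hy i hi]
  · simp [ha i hi]

end Cells

/-! ### Counting signed endpoints of an interval. -/

/-- The signs of the local optima of a one-dimensional linear program cancel. -/
theorem sum_sign_filter_eq_zero {J : Type*} [DecidableEq J] {S : Finset J} {δ s : J → ℝ}
    (hs : Set.InjOn s S) (hδ : ∀ j ∈ S, δ j ≠ 0)
    (hpos : ∃ j ∈ S, 0 < δ j) (hneg : ∃ j ∈ S, δ j < 0)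
    [DecidablePred fun j => ∀ k ∈ S, k ≠ j → s j * δ k < s k * δ k] :
    ∑ j ∈ S.filter (fun j => ∀ k ∈ S, k ≠ j → s j * δ k < s k * δ k), (SignType.sign (δ j) : ℝ)
      = 0 := by
  obtain ⟨j₁, hj₁, hj₁'⟩ := hpos
  obtain ⟨j₂, hj₂, hj₂'⟩ := hneg
  -- The constraints `x * δ k ≤ s k * δ k` define the interval `[s b, s a]`. The filter keeps the
  -- `j` for which `s j` is feasible and all other constraints are slack.
  obtain ⟨a, ha, hamin⟩ := (S.filter fun j => 0 < δ j).exists_min_image s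
    ⟨j₁, by simp [hj₁, hj₁']⟩
  obtain ⟨b, hb, hbmax⟩ := (S.filter fun j => δ j < 0).exists_max_image s
    ⟨j₂, by simp [hj₂, hj₂']⟩
  simp only [Finset.mem_filter] at ha hb hamin hbmax
  have hab : a ≠ b := fun h => lt_asymm ha.2 (h ▸ hb.2)
  have key : ∀ j ∈ S, (∀ k ∈ S, k ≠ j → s j * δ k < s k * δ k) ↔
      (s b < s a ∧ (j = a ∨ j = b)) := by
    intro j hj
    constructor
    · intro h
      rcases (hδ j hj).lt_or_gt with hjn | hjp
      · have hja : s j < s a := lt_of_mul_lt_mul_right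
          (h a ha.1 fun h => lt_asymm ha.2 (h ▸ hjn)) ha.2.le
        have hjb : j = b := by
          by_contra hne
          have h1 := (mul_lt_mul_right_of_neg hb.2).1 (h b hb.1 (Ne.symm hne))
          exact absurd (hbmax j ⟨hj, hjn⟩) h1.not_ge
        exact ⟨hjb ▸ hja, Or.inr hjb⟩
      · have hjb : s b < s j := (mul_lt_mul_right_of_neg hb.2).1
          (h b hb.1 fun h => lt_asymm hjp (h ▸ hb.2))
        have hja : j = a := by
          by_contra hne
          have h1 := lt_of_mul_lt_mul_right (h a ha.1 (Ne.symm hne)) ha.2.le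
          exact absurd (hamin j ⟨hj, hjp⟩) h1.not_ge
        exact ⟨hja ▸ hjb, Or.inl hja⟩
    · rintro ⟨hlt, hor⟩ k hk hkj
      have hsk : s k ≠ s j := fun h => hkj (hs hk hj h)
      rcases (hδ k hk).lt_or_gt with hkn | hkp
      · refine (mul_lt_mul_right_of_neg hkn).2 ?_
        have h1 := hbmax k ⟨hk, hkn⟩
        rcases hor with rfl | rfl
        · exact h1.trans_lt hlt
        · exact lt_of_le_of_ne h1 hsk
      · refine mul_lt_mul_of_pos_right ?_ hkp
        have h1 := hamin k ⟨hk, hkp⟩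
        rcases hor with rfl | rfl
        · exact lt_of_le_of_ne h1 hsk.symm
        · exact hlt.trans_le h1
  rw [Finset.filter_congr key]
  by_cases hlt : s b < s a
  · have : S.filter (fun j => s b < s a ∧ (j = a ∨ j = b)) = {a, b} := by
      ext j
      simp only [Finset.mem_filter, Finset.mem_insert, Finset.mem_singleton, hlt, true_and]
      exact ⟨fun h => h.2, fun h => ⟨by rcases h with rfl | rfl; exacts [ha.1, hb.1], h⟩⟩
    rw [this, Finset.sum_pair hab, sign_pos ha.2, sign_neg hb.2]
    simp
  · simp [hlt]

/-- A one-dimensional linear program whose constraints all point the same way has exactly one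
local optimum. -/
theorem sum_sign_filter_eq_one {J : Type*} [DecidableEq J] {S : Finset J} {δ s : J → ℝ}
    (hs : Set.InjOn s S) (hne : S.Nonempty) (hpos : ∀ j ∈ S, 0 < δ j)
    [DecidablePred fun j => ∀ k ∈ S, k ≠ j → s j * δ k < s k * δ k] :
    ∑ j ∈ S.filter (fun j => ∀ k ∈ S, k ≠ j → s j * δ k < s k * δ k), (SignType.sign (δ j) : ℝ)
      = 1 := by
  obtain ⟨a, ha, hamin⟩ := S.exists_min_image s hne
  have : S.filter (fun j => ∀ k ∈ S, k ≠ j → s j * δ k < s k * δ k) = {a} := by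
    ext j
    simp only [Finset.mem_filter, Finset.mem_singleton]
    constructor
    · rintro ⟨hj, h⟩
      by_contra hne
      have h1 := lt_of_mul_lt_mul_right (h a ha (Ne.symm hne)) (hpos a ha).le
      exact absurd (hamin j hj) h1.not_ge
    · rintro rfl
      refine ⟨ha, fun k hk hkj => mul_lt_mul_of_pos_right ?_ (hpos k hk)⟩
      exact lt_of_le_of_ne (hamin k hk) fun h => hkj (hs hk ha h.symm)
  rw [this, Finset.sum_singleton, sign_pos (hpos a ha)]
  simp

theorem sum_sign_filter_eq_neg_one {J : Type*} [DecidableEq J] {S : Finset J} {δ s : J → ℝ}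
    (hs : Set.InjOn s S) (hne : S.Nonempty) (hneg : ∀ j ∈ S, δ j < 0)
    [DecidablePred fun j => ∀ k ∈ S, k ≠ j → s j * δ k < s k * δ k] :
    ∑ j ∈ S.filter (fun j => ∀ k ∈ S, k ≠ j → s j * δ k < s k * δ k), (SignType.sign (δ j) : ℝ)
      = -1 := by
  classical
  -- Negating both `δ` and `s` preserves the products and flips every sign.
  have h := sum_sign_filter_eq_one (S := S) (δ := fun j => -δ j) (s := fun j => -s j)
    (fun i hi j hj h => hs hi hj (neg_injective h)) hne (fun j hj => neg_pos.2 (hneg j hj))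
  simp only [neg_mul_neg, Left.sign_neg, SignType.coe_neg, Finset.sum_neg_distrib] at h
  rw [← h, neg_neg]

/-! ### The Fourier transform of a simplicial cone. -/

/-- The matrix whose columns are the vectors `u i`. -/
def colMatrix {d : ℕ} (u : Fin d → EuclideanSpace ℝ (Fin d)) : Matrix (Fin d) (Fin d) ℝ :=
  Matrix.of fun k l => u l k

/-- The open simplicial cone with apex `v` generated by the vectors `u i`. -/
def simplicialCone {d : ℕ} (v : EuclideanSpace ℝ (Fin d))
    (u : Fin d → EuclideanSpace ℝ (Fin d)) : Set (EuclideanSpace ℝ (Fin d)) :=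
  {x | ∃ t : Fin d → ℝ, (∀ i, 0 < t i) ∧ x = v + ∑ i, t i • u i}

theorem pairing_add {d : ℕ} (x y : EuclideanSpace ℝ (Fin d)) (ξ : Fin d → ℂ) :
    pairing (x + y) ξ = pairing x ξ + pairing y ξ := by
  simp [pairing, add_mul, Finset.sum_add_distrib]

theorem pairing_sum_smul {d : ℕ} {ι : Type*} (s : Finset ι) (t : ι → ℝ)
    (u : ι → EuclideanSpace ℝ (Fin d)) (ξ : Fin d → ℂ) :
    pairing (∑ i ∈ s, t i • u i) ξ = ∑ i ∈ s, (t i : ℂ) * pairing (u i) ξ := by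
  simp only [pairing, WithLp.ofLp_sum, Finset.sum_apply, PiLp.smul_apply, smul_eq_mul,
    Complex.ofReal_sum, Complex.ofReal_mul, Finset.sum_mul, Finset.mul_sum, mul_assoc]
  exact Finset.sum_comm

theorem fourierKernel_add_sum_smul {d : ℕ} {ι : Type*} (s : Finset ι)
    (v : EuclideanSpace ℝ (Fin d)) (t : ι → ℝ)
    (u : ι → EuclideanSpace ℝ (Fin d)) (ξ : Fin d → ℂ) :
    fourierKernel ξ (v + ∑ i ∈ s, t i • u i) = fourierKernel ξ v *
      ∏ i ∈ s, Complex.exp (-(2 * Real.pi * Complex.I) * pairing (u i) ξ * t i) := by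
  rw [fourierKernel, pairing_add, mul_add, Complex.exp_add, pairing_sum_smul, Finset.mul_sum,
    Complex.exp_sum, fourierKernel]
  congr 1
  exact Finset.prod_congr rfl fun i _ => by ring_nf

theorem re_kernel_exponent {z : ℂ} (hz : z.im < 0) :
    (-(2 * Real.pi * Complex.I) * z).re < 0 := by
  have : (-(2 * Real.pi * Complex.I) * z).re = 2 * Real.pi * z.im := by simp
  rw [this]
  exact mul_neg_of_pos_of_neg Real.two_pi_pos hz

theorem toEuclideanLin_colMatrix {d : ℕ} (u : Fin d → EuclideanSpace ℝ (Fin d))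
    (t : EuclideanSpace ℝ (Fin d)) :
    Matrix.toEuclideanLin (colMatrix u) t = ∑ i, t i • u i := by
  ext k
  simp [Matrix.toEuclideanLin, colMatrix, Matrix.mulVec, dotProduct, mul_comm]

section Simplicial

variable {d : ℕ} (v : EuclideanSpace ℝ (Fin d)) {u : Fin d → EuclideanSpace ℝ (Fin d)}

/-- The affine parametrization of a simplicial cone by the positive orthant. -/
def coneMap (v : EuclideanSpace ℝ (Fin d)) (u : Fin d → EuclideanSpace ℝ (Fin d))
    (t : EuclideanSpace ℝ (Fin d)) : EuclideanSpace ℝ (Fin d) :=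
  v + LinearMap.toContinuousLinearMap (Matrix.toEuclideanLin (colMatrix u)) t

theorem coneMap_apply (t : EuclideanSpace ℝ (Fin d)) :
    coneMap v u t = v + ∑ i, t i • u i := by
  simp only [coneMap, LinearMap.coe_toContinuousLinearMap', toEuclideanLin_colMatrix]

theorem coneMap_injective (hu : LinearIndependent ℝ u) : Function.Injective (coneMap v u) := by
  intro s t h
  rw [coneMap_apply, coneMap_apply] at h
  have h1 : ∑ i, (s i - t i) • u i = 0 := by
    simp only [sub_smul, Finset.sum_sub_distrib, add_left_cancel h, sub_self]
  ext i
  exact sub_eq_zero.1 (Fintype.linearIndependent_iff.1 hu _ h1 i)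

/-- The open positive orthant. -/
def orthant (d : ℕ) : Set (EuclideanSpace ℝ (Fin d)) :=
  WithLp.ofLp ⁻¹' Set.univ.pi fun _ => Set.Ioi 0

theorem measurableSet_orthant : MeasurableSet (orthant d) :=
  (PiLp.volume_preserving_ofLp (Fin d)).measurable
    (MeasurableSet.univ_pi fun _ => measurableSet_Ioi)

theorem simplicialCone_eq_image : simplicialCone v u = coneMap v u '' orthant d := by
  ext x
  constructor
  · rintro ⟨t, ht, rfl⟩
    exact ⟨WithLp.toLp 2 t, fun i _ => ht i, coneMap_apply v _⟩
  · rintro ⟨t, ht, rfl⟩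
    exact ⟨t, fun i => ht i trivial, coneMap_apply v t⟩

theorem hasFDerivWithinAt_coneMap (s : Set (EuclideanSpace ℝ (Fin d)))
    (t : EuclideanSpace ℝ (Fin d)) : HasFDerivWithinAt (coneMap v u)
      (LinearMap.toContinuousLinearMap (Matrix.toEuclideanLin (colMatrix u))) s t :=
  ((ContinuousLinearMap.hasFDerivAt _).const_add v).hasFDerivWithinAt

theorem det_coneMap : (LinearMap.toContinuousLinearMap
    (Matrix.toEuclideanLin (colMatrix u))).det = (colMatrix u).det := by
  rw [LinearMap.det_toContinuousLinearMap, Matrix.toEuclideanLin, Matrix.toLpLin_eq_toLin,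
    LinearMap.det_toLin]

theorem measurableSet_simplicialCone (hu : LinearIndependent ℝ u) :
    MeasurableSet (simplicialCone v u) := by
  rw [simplicialCone_eq_image]
  exact measurableSet_orthant.image_of_continuousOn_injOn
    (fun t _ => (hasFDerivWithinAt_coneMap v _ t).continuousWithinAt)
    (coneMap_injective v hu).injOn

theorem fourierKernel_coneMap (ξ : Fin d → ℂ) (t : EuclideanSpace ℝ (Fin d)) :
    fourierKernel ξ (coneMap v u t) = fourierKernel ξ v *
      ∏ i, Complex.exp (-(2 * Real.pi * Complex.I) * pairing (u i) ξ * t i) := by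
  rw [coneMap_apply, fourierKernel_add_sum_smul]

theorem integrableOn_simplicialCone (hu : LinearIndependent ℝ u) {ξ : Fin d → ℂ}
    (hξ : ∀ i, (pairing (u i) ξ).im < 0) :
    IntegrableOn (fourierKernel ξ) (simplicialCone v u) := by
  rw [simplicialCone_eq_image, integrableOn_image_iff_integrableOn_abs_det_fderiv_smul volume
    measurableSet_orthant (fun t _ => hasFDerivWithinAt_coneMap v _ t)
    (coneMap_injective v hu).injOn]
  refine Integrable.smul _ ?_
  simp only [fourierKernel_coneMap]
  refine Integrable.const_mul ?_ _
  have h : IntegrableOn (fun t : Fin d → ℝ =>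
      ∏ i, Complex.exp (-(2 * Real.pi * Complex.I) * pairing (u i) ξ * t i))
      (Set.univ.pi fun _ => Set.Ioi 0) := by
    rw [IntegrableOn, volume_pi, Measure.restrict_pi_pi]
    exact Integrable.fintype_prod fun i =>
      integrableOn_exp_mul_complex_Ioi (re_kernel_exponent (hξ i)) 0
  exact ((PiLp.volume_preserving_ofLp (Fin d)).integrableOn_comp_preimage
    (MeasurableEquiv.toLp 2 (Fin d → ℝ)).symm.measurableEmbedding).2 h

/-- The linear change of variables to the orthant yields the absolute determinant. Fubini leaves
one-dimensional exponential integrals, whose factors `2πi` cancel the normalization. -/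
theorem indicatorFourier_simplicialCone (hu : LinearIndependent ℝ u) {ξ : Fin d → ℂ}
    (hξ : ∀ i, (pairing (u i) ξ).im < 0) :
    (2 * Real.pi * Complex.I) ^ d * indicatorFourier (simplicialCone v u) ξ =
      ((|(colMatrix u).det| : ℝ) : ℂ) / (∏ i, pairing (u i) ξ) * fourierKernel ξ v := by
  have h : ∫ t in orthant d,
      ∏ i, Complex.exp (-(2 * Real.pi * Complex.I) * pairing (u i) ξ * t i) =
      ∏ i, (2 * Real.pi * Complex.I * pairing (u i) ξ)⁻¹ := by
    rw [orthant, (PiLp.volume_preserving_ofLp (Fin d)).setIntegral_preimage_emb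
      (MeasurableEquiv.toLp 2 (Fin d → ℝ)).symm.measurableEmbedding
      (fun t : Fin d → ℝ =>
        ∏ i, Complex.exp (-(2 * Real.pi * Complex.I) * pairing (u i) ξ * t i)),
      volume_pi, Measure.restrict_pi_pi, integral_fintype_prod_eq_prod
      (fun i (s : ℝ) => Complex.exp (-(2 * Real.pi * Complex.I) * pairing (u i) ξ * s))]
    refine Finset.prod_congr rfl fun i _ => ?_
    rw [integral_exp_mul_complex_Ioi (re_kernel_exponent (hξ i))]
    simp [neg_div_neg_eq]
  have h2 : (2 * Real.pi * Complex.I : ℂ) ≠ 0 := Complex.two_pi_I_ne_zero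
  rw [indicatorFourier, simplicialCone_eq_image,
    integral_image_eq_integral_abs_det_fderiv_smul volume
    measurableSet_orthant (fun t _ => hasFDerivWithinAt_coneMap v _ t)
    (coneMap_injective v hu).injOn, integral_smul, det_coneMap]
  simp only [fourierKernel_coneMap]
  rw [integral_const_mul, h, Complex.real_smul, Finset.prod_inv_distrib, Finset.prod_mul_distrib,
    Finset.prod_const, Finset.card_univ, Fintype.card_fin]
  have h3 : ∏ i, pairing (u i) ξ ≠ 0 :=
    Finset.prod_ne_zero_iff.2 fun i _ h0 => by simpa [h0] using hξ i
  have h4 := pow_ne_zero d h2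
  generalize (2 * Real.pi * Complex.I : ℂ) ^ d = a at *
  field_simp

end Simplicial

/-! ### Pointed cones have a functional positive on the generators. -/

section Cone

variable {d n : ℕ}

/-- Hahn–Banach separates `0` from the convex hull of the generators. If `0` were in that hull, the
line through `v` along some `w i` would lie in the cone. -/
theorem exists_inner_pos_of_containsNoLine {v : EuclideanSpace ℝ (Fin d)}
    {w : Fin n → EuclideanSpace ℝ (Fin d)} (hw : ∀ i, w i ≠ 0)
    (hK : ContainsNoLine (polyCone v w)) : ∃ l, ∀ i, 0 < inner ℝ (w i) l := by
  let C := Fintype.linearCombination ℝ w '' stdSimplex ℝ (Fin n)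
  have h0 : (0 : EuclideanSpace ℝ (Fin d)) ∉ C := by
    rintro ⟨s, ⟨hs, hs1⟩, hsw⟩
    rw [Fintype.linearCombination_apply] at hsw
    obtain ⟨i, -, hi⟩ := Finset.exists_ne_zero_of_sum_ne_zero (hs1.trans_ne one_ne_zero)
    have hi' : 0 < s i := lt_of_le_of_ne (hs i) (Ne.symm hi)
    -- Adding `|t| / s i` times the relation `∑ s j • w j = 0` does not move the point and makes the
    -- coefficient `t` of `w i` nonnegative.
    refine hw i (hK v (w i) fun t => ⟨fun j => |t| / s i * s j + (Pi.single i t : Fin n → ℝ) j, ?_, ?_⟩)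
    · intro j
      dsimp only
      by_cases hj : j = i
      · subst hj
        rw [Pi.single_eq_same, div_mul_cancel₀ _ hi]
        linarith [neg_abs_le t]
      · rw [Pi.single_eq_of_ne hj, add_zero]
        exact mul_nonneg (div_nonneg (abs_nonneg t) hi'.le) (hs j)
    · simp only [add_smul, mul_smul, Finset.sum_add_distrib, ← Finset.smul_sum, hsw, smul_zero,
        zero_add]
      simp [Pi.single_apply]
  have hcont : Continuous (Fintype.linearCombination ℝ w) :=
    LinearMap.continuous_of_finiteDimensional _
  obtain ⟨f, r, hf, hr⟩ := geometric_hahn_banach_point_closed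
    ((convex_stdSimplex ℝ (Fin n)).linear_image (Fintype.linearCombination ℝ w))
    ((isCompact_stdSimplex ℝ (Fin n)).image hcont).isClosed h0
  refine ⟨(InnerProductSpace.toDual ℝ _).symm f, fun i => ?_⟩
  rw [real_inner_comm, InnerProductSpace.toDual_symm_apply]
  rw [map_zero] at hf
  exact hf.trans (hr _ ⟨Pi.single i 1, single_mem_stdSimplex ℝ i, by simp⟩)

end Cone

/-! ### The numerator from a triangulation, and its uniqueness. -/

section Decomposition

variable {d n : ℕ} {v : EuclideanSpace ℝ (Fin d)} {w : Fin n → EuclideanSpace ℝ (Fin d)}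
  {c : Fin n → ℝ} {σ : Finset (Fin n)}

/-- The relatively open cone with apex `v` generated by the vectors `w i`, `i ∈ σ`. -/
def openSubcone (v : EuclideanSpace ℝ (Fin d)) (w : Fin n → EuclideanSpace ℝ (Fin d))
    (σ : Finset (Fin n)) : Set (EuclideanSpace ℝ (Fin d)) :=
  {x | ∃ t : Fin n → ℝ, (∀ i ∈ σ, 0 < t i) ∧ x = v + ∑ i ∈ σ, t i • w i}

theorem openSubcone_map (v : EuclideanSpace ℝ (Fin d)) (w : Fin n → EuclideanSpace ℝ (Fin d))
    (e : Fin d ↪ Fin n) :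
    openSubcone v w (Finset.univ.map e) = simplicialCone v (w ∘ e) := by
  ext x
  constructor
  · rintro ⟨t, ht, rfl⟩
    exact ⟨t ∘ e, fun i => ht _ (by simp), by simp⟩
  · rintro ⟨t, ht, rfl⟩
    refine ⟨Function.extend e t 0, ?_, ?_⟩
    · simp [e.injective.extend_apply, ht]
    · simp [e.injective.extend_apply]

/-- The absolute determinant of the vectors `w i`, `i ∈ σ`. -/
def absDet (w : Fin n → EuclideanSpace ℝ (Fin d)) (σ : Finset (Fin n)) : ℝ :=
  if h : σ.card = d then |(colMatrix (w ∘ σ.orderEmbOfFin h)).det| else 0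

/-- Reordering the columns changes the determinant only by a sign. -/
theorem absDet_map (w : Fin n → EuclideanSpace ℝ (Fin d)) (e : Fin d ↪ Fin n) :
    absDet w (Finset.univ.map e) = |(colMatrix (w ∘ e)).det| := by
  have h : (Finset.univ.map e).card = d := by simp
  have hex : ∀ k, ∃ l, e l = (Finset.univ.map e).orderEmbOfFin h k := fun k => by
    simpa only [Finset.mem_map, Finset.mem_univ, true_and] using
      (Finset.univ.map e).orderEmbOfFin_mem h k
  choose π hπ using hex
  have hinj : Function.Injective π := fun k l hkl =>
    ((Finset.univ.map e).orderEmbOfFin h).injective (by rw [← hπ, ← hπ, hkl])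
  have hbij : Function.Bijective π := Finite.injective_iff_bijective.1 hinj
  rw [absDet, dif_pos h, ← Matrix.abs_det_submatrix_equiv_equiv (Equiv.refl _)
    (Equiv.ofBijective π hbij) (colMatrix (w ∘ e))]
  congr 2
  ext k l
  simp [colMatrix, hπ]

theorem IsCell.card_eq (hσ : IsCell w c σ) : σ.card = d := by
  have h := finrank_span_eq_card (R := ℝ) hσ.1
  have h2 := hσ.2.1
  rw [Set.image_eq_range] at h2
  rw [h2] at h
  simpa using h.symm

theorem IsCell.exists_embedding (hσ : IsCell w c σ) :
    ∃ e : Fin d ↪ Fin n, Finset.univ.map e = σ ∧ LinearIndependent ℝ (w ∘ e) := by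
  obtain ⟨e, he⟩ : ∃ e : Fin d ↪ Fin n, Finset.univ.map e = σ :=
    ⟨(σ.orderEmbOfFin hσ.card_eq).toEmbedding, σ.map_orderEmbOfFin_univ hσ.card_eq⟩
  have hmem : ∀ k, e k ∈ (σ : Set (Fin n)) := fun k => by simp [← he]
  refine ⟨e, he, LinearIndependent.comp hσ.1 (fun k => ⟨e k, hmem k⟩) fun k l h => ?_⟩
  exact e.injective (congrArg Subtype.val h)

theorem IsCell.measurableSet_openSubcone (hσ : IsCell w c σ) :
    MeasurableSet (openSubcone v w σ) := by
  obtain ⟨e, rfl, he⟩ := hσ.exists_embedding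
  rw [openSubcone_map]
  exact measurableSet_simplicialCone v he

theorem IsCell.integrableOn_openSubcone (hσ : IsCell w c σ) {ξ : Fin d → ℂ}
    (hξ : ξ ∈ convergenceDomain w) : IntegrableOn (fourierKernel ξ) (openSubcone v w σ) := by
  obtain ⟨e, rfl, he⟩ := hσ.exists_embedding
  rw [openSubcone_map]
  exact integrableOn_simplicialCone v he fun i => hξ (e i)

theorem IsCell.indicatorFourier_openSubcone (hσ : IsCell w c σ) {ξ : Fin d → ℂ}
    (hξ : ξ ∈ convergenceDomain w) :
    (2 * Real.pi * Complex.I) ^ d * indicatorFourier (openSubcone v w σ) ξ =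
      (absDet w σ : ℂ) / (∏ i ∈ σ, pairing (w i) ξ) * fourierKernel ξ v := by
  obtain ⟨e, rfl, he⟩ := hσ.exists_embedding
  rw [openSubcone_map, indicatorFourier_simplicialCone v he fun i => hξ (e i), absDet_map,
    Finset.prod_map]
  rfl

theorem openSubcone_subset_polyCone : openSubcone v w σ ⊆ polyCone v w := by
  classical
  rintro x ⟨t, ht, rfl⟩
  refine ⟨fun i => if i ∈ σ then t i else 0, fun i => ?_, by simp [ite_smul]⟩
  dsimp only
  split_ifs with hi
  exacts [(ht i hi).le, le_rfl]

open Classical in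
/-- The cells of the triangulation with heights `c`. -/
def cells (w : Fin n → EuclideanSpace ℝ (Fin d)) (c : Fin n → ℝ) : Finset (Finset (Fin n)) :=
  Finset.univ.filter (IsCell w c)

theorem mem_cells : σ ∈ cells w c ↔ IsCell w c σ := by
  simp [cells]

theorem volume_affine_span_eq_zero {S : Submodule ℝ (EuclideanSpace ℝ (Fin d))} (hS : S ≠ ⊤) :
    volume {x | x - v ∈ S} = 0 := by
  have h : {x | x - v ∈ S} = (fun x => x + -v) ⁻¹' (S : Set (EuclideanSpace ℝ (Fin d))) := by
    ext x
    simp [sub_eq_add_neg]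
  rw [h, measure_preimage_add_right]
  exact Measure.addHaar_submodule volume S hS

/-- Points missed by the cells lie in one of finitely many translates of proper spans of generators,
which are null. -/
theorem polyCone_ae_eq_iUnion_cells (hc : IsGeneric w c) {l : EuclideanSpace ℝ (Fin d)}
    (hl : ∀ i, 0 < inner ℝ (w i) l) :
    polyCone v w =ᵐ[volume] ⋃ σ ∈ cells w c, openSubcone v w σ := by
  have hnull : volume (⋃ σ : {σ : Finset (Fin n) //
      Submodule.span ℝ (w '' (σ : Set (Fin n))) ≠ ⊤},
      {x | x - v ∈ Submodule.span ℝ (w '' (σ.1 : Set (Fin n)))}) = 0 :=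
    measure_iUnion_null fun σ => volume_affine_span_eq_zero σ.2
  refine (ae_le_set.2 (measure_mono_null ?_ hnull)).antisymm
    (Filter.Eventually.of_forall (Set.iUnion₂_subset fun σ _ => openSubcone_subset_polyCone))
  rintro x ⟨⟨t, ht, rfl⟩, hx⟩
  by_contra hx'
  refine hx ?_
  simp only [Set.mem_iUnion, not_exists, Subtype.forall] at hx'
  obtain ⟨σ, hσ, s, hs, hsx⟩ := exists_cell_of_generic hc hl ht fun σ hmem => by
    by_contra hne
    exact hx' σ hne (by simpa using hmem)
  exact Set.mem_biUnion (mem_cells.2 hσ) ⟨s, hs, by rw [hsx]⟩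

theorem pairwise_disjoint_cells :
    Set.Pairwise (cells w c : Set (Finset (Fin n))) (Function.onFun Disjoint (openSubcone v w)) := by
  intro σ hσ τ hτ hne
  refine Set.disjoint_left.2 ?_
  rintro x ⟨t, ht, rfl⟩ ⟨s, hs, h⟩
  exact hne ((mem_cells.1 hσ).eq_of_sum_eq (mem_cells.1 hτ) ht hs (add_left_cancel h))

theorem integrableOn_polyCone (hc : IsGeneric w c) {l : EuclideanSpace ℝ (Fin d)}
    (hl : ∀ i, 0 < inner ℝ (w i) l) {ξ : Fin d → ℂ} (hξ : ξ ∈ convergenceDomain w) :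
    IntegrableOn (fourierKernel ξ) (polyCone v w) := by
  refine IntegrableOn.congr_set_ae ?_ (polyCone_ae_eq_iUnion_cells hc hl)
  exact integrableOn_finset_iUnion.2 fun σ hσ =>
    (mem_cells.1 hσ).integrableOn_openSubcone hξ

theorem indicatorFourier_polyCone (hc : IsGeneric w c) {l : EuclideanSpace ℝ (Fin d)}
    (hl : ∀ i, 0 < inner ℝ (w i) l) {ξ : Fin d → ℂ} (hξ : ξ ∈ convergenceDomain w) :
    indicatorFourier (polyCone v w) ξ = ∑ σ ∈ cells w c, indicatorFourier (openSubcone v w σ) ξ := by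
  rw [indicatorFourier, setIntegral_congr_set (polyCone_ae_eq_iUnion_cells hc hl)]
  exact integral_biUnion_finset _ (fun σ hσ => (mem_cells.1 hσ).measurableSet_openSubcone)
    pairwise_disjoint_cells fun σ hσ => (mem_cells.1 hσ).integrableOn_openSubcone hξ

/-- The linear form `ξ ↦ ⟨x, ξ⟩`. -/
def linearForm (x : EuclideanSpace ℝ (Fin d)) : MvPolynomial (Fin d) ℝ :=
  ∑ k, MvPolynomial.C (x k) * MvPolynomial.X k

theorem aeval_linearForm (x : EuclideanSpace ℝ (Fin d)) (ξ : Fin d → ℂ) :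
    MvPolynomial.aeval ξ (linearForm x) = pairing x ξ := by
  simp [linearForm, pairing]

theorem eval_linearForm (x y : EuclideanSpace ℝ (Fin d)) :
    MvPolynomial.eval (fun k => y k) (linearForm x) = inner ℝ y x := by
  simp [linearForm, PiLp.inner_apply]

theorem isHomogeneous_linearForm (x : EuclideanSpace ℝ (Fin d)) :
    (linearForm x).IsHomogeneous 1 :=
  MvPolynomial.IsHomogeneous.sum _ _ _ fun _ _ => MvPolynomial.isHomogeneous_C_mul_X _ _

/-- The numerator of the Fourier transform of a cone, computed from a triangulation. -/
def coneNumerator (w : Fin n → EuclideanSpace ℝ (Fin d)) (c : Fin n → ℝ) :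
    MvPolynomial (Fin d) ℝ :=
  ∑ σ ∈ cells w c, MvPolynomial.C (absDet w σ) * ∏ j ∈ σᶜ, linearForm (w j)

theorem isHomogeneous_coneNumerator : (coneNumerator w c).IsHomogeneous (n - d) := by
  refine MvPolynomial.IsHomogeneous.sum _ _ _ fun σ hσ => ?_
  have h := (MvPolynomial.isHomogeneous_C (Fin d) (absDet w σ)).mul
    (MvPolynomial.IsHomogeneous.prod σᶜ (fun j => linearForm (w j)) (fun _ => 1)
      fun j _ => isHomogeneous_linearForm (w j))
  have h2 : 0 + ∑ _j ∈ σᶜ, 1 = n - d := by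
    rw [zero_add, Finset.sum_const, smul_eq_mul, mul_one, Finset.card_compl, Fintype.card_fin,
      (mem_cells.1 hσ).card_eq]
  rwa [h2] at h

theorem eval_coneNumerator (y : EuclideanSpace ℝ (Fin d)) :
    MvPolynomial.eval (fun k => y k) (coneNumerator w c) =
      ∑ σ ∈ cells w c, absDet w σ * ∏ j ∈ σᶜ, inner ℝ y (w j) := by
  simp only [coneNumerator, map_sum, map_mul, map_prod, MvPolynomial.eval_C, eval_linearForm]

theorem pairing_ne_zero_of_mem {ξ : Fin d → ℂ} (hξ : ξ ∈ convergenceDomain w) (i : Fin n) :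
    pairing (w i) ξ ≠ 0 := fun h => by simpa [h] using hξ i

theorem isFourierNumerator_coneNumerator (hc : IsGeneric w c) {l : EuclideanSpace ℝ (Fin d)}
    (hl : ∀ i, 0 < inner ℝ (w i) l) : IsFourierNumerator v w (coneNumerator w c) := by
  intro ξ hξ
  rw [indicatorFourier_polyCone hc hl hξ, Finset.mul_sum, coneNumerator, map_sum, Finset.sum_div,
    Finset.sum_mul]
  refine Finset.sum_congr rfl fun σ hσ => ?_
  rw [(mem_cells.1 hσ).indicatorFourier_openSubcone hξ, map_mul, map_prod]
  simp only [aeval_linearForm]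
  congr 1
  have h1 : ∏ j ∈ σᶜ, pairing (w j) ξ ≠ 0 :=
    Finset.prod_ne_zero_iff.2 fun j _ => pairing_ne_zero_of_mem hξ j
  rw [← Finset.prod_mul_prod_compl σ, mul_div_mul_right _ _ h1]
  simp

/-- The points with coordinates `a k - I * l k`, `a k` real, lie in the convergence domain and form
a product of infinite sets, on which a polynomial is determined by its values. -/
theorem IsFourierNumerator.unique {l : EuclideanSpace ℝ (Fin d)}
    (hl : ∀ i, 0 < inner ℝ (w i) l) {p q : MvPolynomial (Fin d) ℝ}
    (hp : IsFourierNumerator v w p) (hq : IsFourierNumerator v w q) : p = q := by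
  refine MvPolynomial.map_injective (algebraMap ℝ ℂ) (algebraMap ℝ ℂ).injective ?_
  refine MvPolynomial.funext_set
    (fun k => Set.range fun a : ℝ => (a : ℂ) - Complex.I * (l k : ℂ)) (fun k => ?_) ?_
  · exact Set.infinite_range_of_injective fun a b hab => by simpa using hab
  intro ξ hξ
  choose a ha using fun k => hξ k trivial
  have hdom : ξ ∈ convergenceDomain w := by
    intro i
    have h := hl i
    have him : (pairing (w i) ξ).im = -inner ℝ (w i) l := by
      simp only [pairing, ← ha, Complex.im_sum, PiLp.inner_apply]
      simp [mul_comm]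
    rw [him]
    linarith
  have h := (hp ξ hdom).symm.trans (hq ξ hdom)
  have h1 : fourierKernel ξ v ≠ 0 := Complex.exp_ne_zero _
  have h2 : ∏ i, pairing (w i) ξ ≠ 0 :=
    Finset.prod_ne_zero_iff.2 fun j _ => pairing_ne_zero_of_mem hdom j
  have h3 := mul_right_cancel₀ h1 h
  rw [div_left_inj' h2] at h3
  simpa only [MvPolynomial.eval_map, MvPolynomial.aeval_def] using h3

end Decomposition

/-! ### Evaluating the numerator at the generalized cross product. -/

section Diagonal

variable {m n : ℕ} {v : EuclideanSpace ℝ (Fin (m + 1))}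
  {w : Fin n → EuclideanSpace ℝ (Fin (m + 1))} {c : Fin n → ℝ} {D : Fin m ↪ Fin n}

theorem detLast_eq_det_colMatrix (xs : Fin m → EuclideanSpace ℝ (Fin (m + 1)))
    (x : EuclideanSpace ℝ (Fin (m + 1))) :
    detLast xs x = (colMatrix (Fin.snoc xs x : Fin (m + 1) → _)).det := rfl

theorem detLast_apply_self (xs : Fin m → EuclideanSpace ℝ (Fin (m + 1))) (i : Fin m) :
    detLast xs (xs i) = 0 := by
  rw [detLast_eq_det_colMatrix]
  exact Matrix.det_zero_of_column_eq (Fin.castSucc_lt_last i).ne fun k => by simp [colMatrix]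

theorem linearIndependent_of_det_colMatrix_ne_zero {d : ℕ} {u : Fin d → EuclideanSpace ℝ (Fin d)}
    (h : (colMatrix u).det ≠ 0) : LinearIndependent ℝ u := by
  refine Fintype.linearIndependent_iff.2 fun g hg => congrFun ?_
  refine Matrix.eq_zero_of_mulVec_eq_zero h ?_
  have h1 := toEuclideanLin_colMatrix u (WithLp.toLp 2 g)
  rw [hg] at h1
  exact congrArg WithLp.ofLp h1

theorem linearIndependent_snoc {xs : Fin m → EuclideanSpace ℝ (Fin (m + 1))}
    {x : EuclideanSpace ℝ (Fin (m + 1))} (h : detLast xs x ≠ 0) :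
    LinearIndependent ℝ (Fin.snoc xs x : Fin (m + 1) → EuclideanSpace ℝ (Fin (m + 1))) :=
  linearIndependent_of_det_colMatrix_ne_zero h

theorem exists_snoc_embedding (w : Fin n → EuclideanSpace ℝ (Fin (m + 1))) {j : Fin n}
    (hj : j ∉ Finset.univ.map D) : ∃ e : Fin (m + 1) ↪ Fin n,
      Finset.univ.map e = insert j (Finset.univ.map D) ∧
        w ∘ e = Fin.snoc (fun k => w (D k)) (w j) := by
  have hj' : j ∉ Set.range D := by simpa using hj
  refine ⟨Fin.Embedding.snoc D hj', ?_, ?_⟩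
  · ext i
    simp only [Finset.mem_map, Finset.mem_univ, true_and, Finset.mem_insert, Fin.exists_fin_succ',
      Fin.Embedding.coe_snoc, Fin.snoc_castSucc, Fin.snoc_last]
    tauto
  · ext k : 1
    refine Fin.lastCases ?_ (fun k => ?_) k <;> simp

theorem absDet_insert {j : Fin n} (hj : j ∉ Finset.univ.map D) :
    absDet w (insert j (Finset.univ.map D)) = |detLast (fun k => w (D k)) (w j)| := by
  obtain ⟨e, he, hwe⟩ := exists_snoc_embedding w hj
  rw [← he, absDet_map, hwe, detLast_eq_det_colMatrix]

theorem linearIndepOn_insert_diagonal {j : Fin n} (hj : j ∉ Finset.univ.map D)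
    (hδ : detLast (fun k => w (D k)) (w j) ≠ 0) :
    LinearIndepOn ℝ w (insert j (Finset.univ.map D) : Finset (Fin n)) ∧
      Submodule.span ℝ (w '' (insert j (Finset.univ.map D) : Finset (Fin n))) = ⊤ := by
  obtain ⟨e, he, hwe⟩ := exists_snoc_embedding w hj
  have hli := linearIndependent_snoc hδ
  rw [← hwe] at hli
  rw [← he]
  have hr : ((Finset.univ.map e : Finset (Fin n)) : Set (Fin n)) = Set.range e := by simp
  rw [hr, ← Set.range_comp]
  exact ⟨(linearIndepOn_range_iff e.injective w).2 hli,
    hli.span_eq_top_of_card_eq_finrank (by simp)⟩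

theorem detLast_eq_zero_of_mem {i : Fin n} (hi : i ∈ Finset.univ.map D) :
    detLast (fun k => w (D k)) (w i) = 0 := by
  obtain ⟨k, -, rfl⟩ := Finset.mem_map.1 hi
  exact detLast_apply_self (fun k => w (D k)) k

theorem eq_of_inner_eq_of_span_eq_top {E ι : Type*} [NormedAddCommGroup E] [InnerProductSpace ℝ E]
    {w : ι → E} {s : Set ι} (hs : Submodule.span ℝ (w '' s) = ⊤) {y z : E}
    (h : ∀ i ∈ s, inner ℝ (w i) y = inner ℝ (w i) z) : y = z := by
  have h1 : ∀ x ∈ Submodule.span ℝ (w '' s), inner ℝ x (y - z) = 0 := by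
    intro x hx
    induction hx using Submodule.span_induction with
    | mem x hx =>
      obtain ⟨i, hi, rfl⟩ := hx
      rw [inner_sub_right, h i hi, sub_self]
    | zero => exact inner_zero_left _
    | add a b _ _ ha hb => rw [inner_add_left, ha, hb, add_zero]
    | smul r a _ ha => rw [real_inner_smul_left, ha, mul_zero]
  exact sub_eq_zero.1 (inner_self_eq_zero.1 (h1 (y - z) (hs ▸ Submodule.mem_top)))

theorem inner_add_smul_genCross (x y : EuclideanSpace ℝ (Fin (m + 1))) (r : ℝ)
    (xs : Fin m → EuclideanSpace ℝ (Fin (m + 1))) :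
    inner ℝ x (y + r • genCross xs) = inner ℝ x y + r * detLast xs x := by
  rw [inner_add_right, real_inner_smul_right, real_inner_comm (genCross xs) x, inner_genCross]

/-- The cells containing a diagonal are the local optima of the linear program on the line of
points that are tight at the diagonal. -/
theorem isCell_insert_iff {y₀ : EuclideanSpace ℝ (Fin (m + 1))}
    (hy₀ : ∀ i ∈ Finset.univ.map D, inner ℝ (w i) y₀ = c i) {s : Fin n → ℝ}
    (hs : ∀ k, k ∉ Finset.univ.map D →
      inner ℝ (w k) y₀ + s k * detLast (fun k => w (D k)) (w k) = c k)
    {j : Fin n} (hj : j ∉ Finset.univ.map D) (hδ : detLast (fun k => w (D k)) (w j) ≠ 0) :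
    IsCell w c (insert j (Finset.univ.map D)) ↔ ∀ k ∈ (Finset.univ.map D)ᶜ, k ≠ j →
      s j * detLast (fun k => w (D k)) (w k) < s k * detLast (fun k => w (D k)) (w k) := by
  obtain ⟨hli, hspan⟩ := linearIndepOn_insert_diagonal hj hδ
  set y := y₀ + s j • genCross (fun k => w (D k)) with hy
  have hyk : ∀ k, inner ℝ (w k) y = inner ℝ (w k) y₀ + s j * detLast (fun k => w (D k)) (w k) :=
    fun k => inner_add_smul_genCross _ _ _ _
  have hyσ : ∀ i ∈ insert j (Finset.univ.map D), inner ℝ (w i) y = c i := by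
    intro i hi
    rcases Finset.mem_insert.1 hi with rfl | hi
    · rw [hyk, hs i hj]
    · rw [hyk, detLast_eq_zero_of_mem hi, mul_zero, add_zero, hy₀ i hi]
  have key : ∀ k, k ∉ Finset.univ.map D → (inner ℝ (w k) y < c k ↔
      s j * detLast (fun k => w (D k)) (w k) < s k * detLast (fun k => w (D k)) (w k)) := by
    intro k hk
    rw [hyk, ← hs k hk, add_lt_add_iff_left]
  constructor
  · rintro ⟨-, -, z, hz, hz'⟩ k hk hkj
    -- The tight equations on a spanning set have only one solution, so any certificate `z` is the
    -- point `y` of the line.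
    have hyz : y = z := eq_of_inner_eq_of_span_eq_top hspan fun i hi =>
      (hyσ i hi).trans (hz i hi).symm
    rw [Finset.mem_compl] at hk
    rw [← key k hk, hyz]
    exact hz' k (by simp only [Finset.mem_insert, not_or]; exact ⟨hkj, hk⟩)
  · intro h
    refine ⟨hli, hspan, y, hyσ, fun k hk => ?_⟩
    simp only [Finset.mem_insert, not_or] at hk
    exact (key k hk.2).2 (h k (Finset.mem_compl.2 hk.2) hk.1)

-- A cell missing some `i` in `D` has the zero factor `det (D, w i)`. By cardinality a cell
-- containing `D` is `D ∪ {j}`, and its absolute determinant equals the sign times the missing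
-- factor `det (D, w j)`.
open Classical in
theorem eval_genCross_coneNumerator :
    MvPolynomial.eval (fun k => genCross (fun k => w (D k)) k) (coneNumerator w c) =
      (∑ j ∈ (Finset.univ.map D)ᶜ.filter fun j => IsCell w c (insert j (Finset.univ.map D)),
        (SignType.sign (detLast (fun k => w (D k)) (w j)) : ℝ)) *
      ∏ j ∈ (Finset.univ.map D)ᶜ, detLast (fun k => w (D k)) (w j) := by
  simp only [eval_coneNumerator, inner_genCross]
  rw [Finset.sum_mul]
  symm
  refine Finset.sum_of_injOn (fun j => insert j (Finset.univ.map D)) ?_ ?_ ?_ ?_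
  · intro j hj k hk hjk
    simp only [Finset.coe_filter, Finset.mem_compl, Set.mem_ofPred_eq] at hj hk
    have hjk' : insert j (Finset.univ.map D) = insert k (Finset.univ.map D) := hjk
    have h : j ∈ insert k (Finset.univ.map D) := hjk' ▸ Finset.mem_insert_self j _
    exact (Finset.mem_insert.1 h).resolve_right hj.1
  · intro j hj
    exact mem_cells.2 (Finset.mem_filter.1 hj).2
  · intro σ hσ hσ'
    by_cases hsub : Finset.univ.map D ⊆ σ
    · obtain ⟨j, hj, rfl⟩ := Finset.exists_eq_insert_iff.2
        ⟨hsub, by rw [(mem_cells.1 hσ).card_eq]; simp⟩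
      exact absurd ⟨j, by simpa using ⟨by simpa using hj, mem_cells.1 hσ⟩, rfl⟩ hσ'
    · obtain ⟨i, hi, hiσ⟩ := Finset.not_subset.1 hsub
      rw [Finset.prod_eq_zero (Finset.mem_compl.2 hiσ) (detLast_eq_zero_of_mem hi), mul_zero]
  · intro j hj
    obtain ⟨hj, -⟩ := Finset.mem_filter.1 hj
    rw [absDet_insert (Finset.mem_compl.1 hj), Finset.compl_insert, ← Finset.mul_prod_erase _ _ hj,
      ← mul_assoc, sign_mul_self]

open Classical in
theorem exists_eval_genCross_eq_sum_sign (hc : IsGeneric w c)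
    (hδ : ∀ j ∈ (Finset.univ.map D)ᶜ, detLast (fun k => w (D k)) (w j) ≠ 0)
    (hne : ((Finset.univ.map D)ᶜ : Finset (Fin n)).Nonempty) :
    ∃ s : Fin n → ℝ, Set.InjOn s ((Finset.univ.map D)ᶜ : Finset (Fin n)) ∧
      MvPolynomial.eval (fun k => genCross (fun k => w (D k)) k) (coneNumerator w c) =
      (∑ j ∈ (Finset.univ.map D)ᶜ.filter fun j => ∀ k ∈ (Finset.univ.map D)ᶜ, k ≠ j →
          s j * detLast (fun k => w (D k)) (w k) < s k * detLast (fun k => w (D k)) (w k),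
        (SignType.sign (detLast (fun k => w (D k)) (w j)) : ℝ)) *
      ∏ j ∈ (Finset.univ.map D)ᶜ, detLast (fun k => w (D k)) (w j) := by
  obtain ⟨j₀, hj₀⟩ := hne
  have hli := (linearIndepOn_insert_diagonal (Finset.mem_compl.1 hj₀) (hδ j₀ hj₀)).1
  obtain ⟨y₀, hy₀⟩ := exists_inner_eq_of_linearIndepOn
    (hli.mono (Finset.coe_subset.2 (Finset.subset_insert _ _))) c
  -- The parameter at which constraint `k` becomes tight on the line `y₀ + s • D*`.
  let s : Fin n → ℝ := fun k =>
    (c k - inner ℝ (w k) y₀) / detLast (fun k => w (D k)) (w k)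
  have hs : ∀ k, k ∉ Finset.univ.map D →
      inner ℝ (w k) y₀ + s k * detLast (fun k => w (D k)) (w k) = c k := fun k hk => by
    rw [div_mul_cancel₀ _ (hδ k (Finset.mem_compl.2 hk)), add_sub_cancel]
  refine ⟨s, fun j hj k hk hjk => ?_, ?_⟩
  · by_contra hne
    have hj' := Finset.mem_compl.1 hj
    have hk' := Finset.mem_compl.1 hk
    obtain ⟨hli, hspan⟩ := linearIndepOn_insert_diagonal hj' (hδ j hj)
    obtain ⟨a, ha, haw⟩ := exists_coeff_of_mem_span_image (x := w k)
      (hspan ▸ Submodule.mem_top)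
    -- If `s j = s k`, one point is tight on `D`, `j` and `k`. The lifted `w k` then lies in the
    -- span of the lifted basis `D ∪ {j}`, which genericity excludes.
    refine hc _ hli k (by simp only [Finset.mem_insert, not_or]; exact ⟨Ne.symm hne, hk'⟩)
      a ha haw ?_
    rw [← hs k hk', ← hjk, ← inner_add_smul_genCross, ← haw, sum_inner]
    refine Finset.sum_congr rfl fun i _ => ?_
    rw [real_inner_smul_left]
    by_cases hi : i ∈ insert j (Finset.univ.map D)
    · congr 1
      rw [inner_add_smul_genCross]
      rcases Finset.mem_insert.1 hi with rfl | hi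
      · exact (hs i hj').symm
      · rw [detLast_eq_zero_of_mem hi, mul_zero, add_zero, hy₀ i hi]
    · rw [ha i hi, zero_mul, zero_mul]
  · rw [eval_genCross_coneNumerator, Finset.filter_congr fun j hj =>
      isCell_insert_iff hy₀ hs (Finset.mem_compl.1 hj) (hδ j hj)]

end Diagonal

/-! ### Extremality and the signs of the determinants. -/

section Extremal

variable {m n : ℕ} {v : EuclideanSpace ℝ (Fin (m + 1))}
  {w : Fin n → EuclideanSpace ℝ (Fin (m + 1))} {D : Fin m ↪ Fin n}

theorem polyCone_comp_embedding_subset {p : ℕ} (e : Fin p ↪ Fin n) :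
    polyCone v (fun k => w (e k)) ⊆ polyCone v w := by
  rintro x ⟨t, ht, rfl⟩
  refine ⟨Function.extend e t 0, fun i => ?_, ?_⟩
  · by_cases hi : ∃ k, e k = i
    · obtain ⟨k, rfl⟩ := hi
      rw [e.injective.extend_apply]
      exact ht k
    · rw [Function.extend_apply' _ _ _ hi]
      rfl
  · congr 1
    rw [← Finset.sum_subset (Finset.subset_univ (Finset.univ.map e)), Finset.sum_map]
    · simp [e.injective.extend_apply]
    · intro i _ hi
      rw [Function.extend_apply' _ _ _ (by simpa using hi), Pi.zero_apply, zero_smul]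

theorem detLast_sum_smul (xs : Fin m → EuclideanSpace ℝ (Fin (m + 1))) {ι : Type*}
    (s : Finset ι) (t : ι → ℝ) (u : ι → EuclideanSpace ℝ (Fin (m + 1))) :
    detLast xs (∑ i ∈ s, t i • u i) = ∑ i ∈ s, t i * detLast xs (u i) := by
  simp only [← inner_genCross, inner_sum, real_inner_smul_right]

/-- A diagonal is extremal if all generators lie on one side of its hyperplane. -/
theorem isExtremal_of_forall_nonneg {r : ℝ}
    (hr : ∀ j, 0 ≤ r * detLast (fun k => w (D k)) (w j)) {j₀ : Fin n}
    (hj₀ : r * detLast (fun k => w (D k)) (w j₀) ≠ 0) : IsExtremal v w D := by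
  set g := r • genCross (fun k => w (D k)) with hg
  have hgi : ∀ x, inner ℝ g x = r * detLast (fun k => w (D k)) x := fun x => by
    rw [hg, real_inner_smul_left, inner_genCross]
  have hg0 : g ≠ 0 := fun h => hj₀ (by rw [← hgi, h, inner_zero_left])
  have hnonneg : ∀ x ∈ polyCone v w, 0 ≤ inner ℝ g (x - v) := by
    rintro x ⟨t, ht, rfl⟩
    rw [add_sub_cancel_left, inner_sum]
    refine Finset.sum_nonneg fun i _ => ?_
    rw [real_inner_smul_right, hgi]
    exact mul_nonneg (ht i) (hr i)
  intro x hx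
  refine ⟨subset_closure (polyCone_comp_embedding_subset D hx), fun hint => ?_⟩
  obtain ⟨t, -, rfl⟩ := hx
  -- The functional `g` is nonnegative on the cone and zero on the diagonal, so any small push along
  -- `-g` leaves the cone.
  have hcont : Continuous fun a : ℝ => v + ∑ i, t i • w (D i) - a • g := by fun_prop
  have h1 : ∀ᶠ a : ℝ in nhds 0, v + ∑ i, t i • w (D i) - a • g ∈ polyCone v w :=
    hcont.continuousAt.eventually (by simpa using mem_interior_iff_mem_nhds.1 hint)
  obtain ⟨a, ha, ha0⟩ :=
    ((h1.filter_mono nhdsWithin_le_nhds).and (self_mem_nhdsWithin (s := Set.Ioi (0 : ℝ)))).exists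
  have h2 := hnonneg _ ha
  have h3 : inner ℝ g (∑ i, t i • w (D i)) = 0 := by
    rw [hgi, detLast_sum_smul]
    simp [detLast_apply_self (fun k => w (D k))]
  have h4 : v + ∑ i, t i • w (D i) - a • g - v = ∑ i, t i • w (D i) - a • g := by abel
  rw [h4, inner_sub_right, h3, real_inner_smul_right, zero_sub] at h2
  have h5 : 0 < a * inner ℝ g g := mul_pos ha0 (real_inner_self_pos.2 hg0)
  linarith

/-- The points whose coordinates along the diagonal are positive and that lie on the side of the
generator `w j` belong to the cone. -/
theorem exists_isOpen_diagonal {j : Fin n} (hj : j ∉ Finset.univ.map D)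
    (hδ : detLast (fun k => w (D k)) (w j) ≠ 0) :
    ∃ U : Set (EuclideanSpace ℝ (Fin (m + 1))), IsOpen U ∧ v + ∑ i, w (D i) ∈ U ∧ ∀ x ∈ U,
      0 ≤ detLast (fun k => w (D k)) (x - v) * detLast (fun k => w (D k)) (w j) →
        x ∈ polyCone v w := by
  obtain ⟨e, -, hwe⟩ := exists_snoc_embedding w hj
  have hwi : ∀ i : Fin m, w (e i.castSucc) = w (D i) := fun i => by
    simpa using congrFun hwe i.castSucc
  have hwl : w (e (Fin.last m)) = w j := by simpa using congrFun hwe (Fin.last m)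
  have hli := linearIndependent_snoc hδ
  rw [← hwe] at hli
  let B := basisOfLinearIndependentOfCardEqFinrank hli (by simp)
  have hB : ∀ k, B k = w (e k) := fun k => by simp [B]
  have hcoord : ∀ k, Continuous fun x => B.coord k (x - v) := fun k =>
    (LinearMap.continuous_of_finiteDimensional (B.coord k)).comp (continuous_id.sub continuous_const)
  -- In the basis `D`, `w j`, the last coordinate of `x - v` times `det (D, w j)` is `det (D, x -
  -- v)`. The sign condition is thus nonnegativity of that coordinate.
  refine ⟨{x | ∀ i : Fin m, 0 < B.coord i.castSucc (x - v)}, ?_, ?_, ?_⟩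
  · simp only [Set.ofPred_forall]
    exact isOpen_iInter_of_finite fun i => isOpen_lt continuous_const (hcoord _)
  · intro i
    rw [add_sub_cancel_left]
    simp_rw [← hwi, ← hB]
    simp [Finsupp.single_apply]
  · intro x hx hx'
    have hsum : x - v = ∑ k, B.coord k (x - v) • w (e k) := by
      conv_lhs => rw [← B.sum_repr (x - v)]
      simp only [hB, Module.Basis.coord_apply]
    have hdet : detLast (fun k => w (D k)) (x - v) =
        B.coord (Fin.last m) (x - v) * detLast (fun k => w (D k)) (w j) := by
      conv_lhs => rw [hsum]
      rw [detLast_sum_smul, Fin.sum_univ_castSucc, hwl]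
      simp [hwi, detLast_apply_self (fun k => w (D k))]
    rw [hdet, mul_assoc] at hx'
    refine polyCone_comp_embedding_subset e ⟨fun k => B.coord k (x - v), fun k => ?_, ?_⟩
    · refine Fin.lastCases ?_ (fun i => (hx i).le) k
      exact nonneg_of_mul_nonneg_left hx' (mul_self_pos.2 hδ)
    · rw [← hsum, add_sub_cancel]

/-- The generators lie on one side of the hyperplane of an extremal diagonal. -/
theorem IsExtremal.not_pos_neg (hD : IsExtremal v w D) {j k : Fin n}
    (hj : 0 < detLast (fun k => w (D k)) (w j)) (hk : detLast (fun k => w (D k)) (w k) < 0) :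
    False := by
  have hj' : j ∉ Finset.univ.map D := fun h => hj.ne' (detLast_eq_zero_of_mem h)
  have hk' : k ∉ Finset.univ.map D := fun h => hk.ne (detLast_eq_zero_of_mem h)
  obtain ⟨U, hU, hxU, hUK⟩ := exists_isOpen_diagonal (v := v) hj' hj.ne'
  obtain ⟨V, hV, hxV, hVK⟩ := exists_isOpen_diagonal (v := v) hk' hk.ne
  -- Near this point of the diagonal, each side of the hyperplane is covered by the simplicial cone
  -- of `D` with `w j` or `w k`, so the point is interior to the cone.
  refine (hD ⟨fun _ => 1, fun _ => zero_le_one, by simp only [one_smul]⟩ :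
    v + ∑ i, w (D i) ∈ frontier (polyCone v w)).2 (mem_interior.2 ⟨U ∩ V, ?_, hU.inter hV,
      hxU, hxV⟩)
  rintro x ⟨hx, hx'⟩
  rcases le_total 0 (detLast (fun k => w (D k)) (x - v)) with h | h
  · exact hUK x hx (mul_nonneg h hj.le)
  · exact hVK x hx' (mul_nonneg_of_nonpos_of_nonpos h hk.le)

end Extremal
end ConicFourier
end

/-! ### Assembly of the theorem. -/

open ConicFourier
theorem mainTheorem1 {m n : ℕ} (hn : m + 1 ≤ n)
    (v : EuclideanSpace ℝ (Fin (m + 1))) (w : Fin n → EuclideanSpace ℝ (Fin (m + 1)))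
    (hw : ∀ i, w i ≠ 0) (hK : ContainsNoLine (polyCone v w)) :
    (∀ ξ ∈ convergenceDomain w, IntegrableOn (fourierKernel ξ) (polyCone v w)) ∧
    (∃! p : MvPolynomial (Fin (m + 1)) ℝ, IsFourierNumerator v w p) ∧
    ∀ p : MvPolynomial (Fin (m + 1)) ℝ, IsFourierNumerator v w p →
      p.IsHomogeneous (n - (m + 1)) ∧
      ∀ D : Fin m ↪ Fin n,
        (IsExtremal v w D →
          ∃ ε : ℝ, (ε = 1 ∨ ε = -1) ∧
            (∀ j ∉ Finset.univ.map D, detLast (fun k => w (D k)) (w j) ≠ 0 →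
              Real.sign (detLast (fun k => w (D k)) (w j)) = ε) ∧
            MvPolynomial.eval (fun k => genCross (fun k => w (D k)) k) p =
              ε * ∏ j ∈ (Finset.univ.map D)ᶜ, detLast (fun k => w (D k)) (w j)) ∧
        (¬ IsExtremal v w D →
          MvPolynomial.eval (fun k => genCross (fun k => w (D k)) k) p = 0) := by
  classical
  obtain ⟨l, hl⟩ := exists_inner_pos_of_containsNoLine hw hK
  obtain ⟨c, hc⟩ := exists_isGeneric w
  have hnum : IsFourierNumerator v w (coneNumerator w c) := isFourierNumerator_coneNumerator hc hl
  refine ⟨fun ξ hξ => integrableOn_polyCone hc hl hξ,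
    ⟨_, hnum, fun q hq => hq.unique hl hnum⟩, fun p hp => ?_⟩
  obtain rfl := hp.unique hl hnum
  refine ⟨isHomogeneous_coneNumerator, fun D => ?_⟩
  have hne : ((Finset.univ.map D)ᶜ : Finset (Fin n)).Nonempty := by
    rw [← Finset.card_pos, Finset.card_compl, Finset.card_map, Finset.card_univ, Fintype.card_fin,
      Fintype.card_fin]
    omega
  have hmem : ∀ j, detLast (fun k => w (D k)) (w j) ≠ 0 → j ∈ (Finset.univ.map D)ᶜ := fun j hj =>
    Finset.mem_compl.2 fun h => hj (detLast_eq_zero_of_mem h)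
  -- A vanishing determinant off `D` kills both sides, extremal or not. This covers dependent
  -- diagonals, since `D` has fewer than `n` members.
  have hzero : ¬ (∀ j ∈ (Finset.univ.map D)ᶜ, detLast (fun k => w (D k)) (w j) ≠ 0) →
      ∏ j ∈ (Finset.univ.map D)ᶜ, detLast (fun k => w (D k)) (w j) = 0 ∧
      MvPolynomial.eval (fun k => genCross (fun k => w (D k)) k) (coneNumerator w c) = 0 := by
    intro h
    push Not at h
    obtain ⟨j, hj, hj0⟩ := h
    have h1 := Finset.prod_eq_zero (f := fun j => detLast (fun k => w (D k)) (w j)) hj hj0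
    exact ⟨h1, by rw [eval_genCross_coneNumerator, h1, mul_zero]⟩
  constructor
  · intro hD
    by_cases hneg : ∃ k, detLast (fun k => w (D k)) (w k) < 0
    · obtain ⟨k, hk⟩ := hneg
      have hle : ∀ j, detLast (fun k => w (D k)) (w j) ≤ 0 := fun j =>
        not_lt.1 fun h => hD.not_pos_neg h hk
      refine ⟨-1, Or.inr rfl, fun j _ hj => Real.sign_of_neg (lt_of_le_of_ne (hle j) hj), ?_⟩
      by_cases h0 : ∀ j ∈ (Finset.univ.map D)ᶜ, detLast (fun k => w (D k)) (w j) ≠ 0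
      · obtain ⟨s, hs, heval⟩ := exists_eval_genCross_eq_sum_sign hc h0 hne
        rw [heval, sum_sign_filter_eq_neg_one hs hne
          fun j hj => lt_of_le_of_ne (hle j) (h0 j hj)]
      · rw [(hzero h0).1, (hzero h0).2, mul_zero]
    · push Not at hneg
      refine ⟨1, Or.inl rfl, fun j _ hj => Real.sign_of_pos (lt_of_le_of_ne (hneg j) hj.symm), ?_⟩
      by_cases h0 : ∀ j ∈ (Finset.univ.map D)ᶜ, detLast (fun k => w (D k)) (w j) ≠ 0
      · obtain ⟨s, hs, heval⟩ := exists_eval_genCross_eq_sum_sign hc h0 hne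
        rw [heval, sum_sign_filter_eq_one hs hne
          fun j hj => lt_of_le_of_ne (hneg j) (h0 j hj).symm]
      · rw [(hzero h0).1, (hzero h0).2, mul_zero]
  · intro hD
    by_cases h0 : ∀ j ∈ (Finset.univ.map D)ᶜ, detLast (fun k => w (D k)) (w j) ≠ 0
    · obtain ⟨j₀, hj₀⟩ := hne
      -- Without a negative determinant all generators would lie on one side and `D` would be
      -- extremal; likewise for `hpos`.
      have hneg : ∃ k, detLast (fun k => w (D k)) (w k) < 0 := by
        by_contra! h
        exact hD (isExtremal_of_forall_nonneg (r := 1) (fun j => by simpa using h j)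
          (j₀ := j₀) (by simpa using h0 j₀ hj₀))
      have hpos : ∃ k, 0 < detLast (fun k => w (D k)) (w k) := by
        by_contra! h
        exact hD (isExtremal_of_forall_nonneg (r := -1) (fun j => by simpa using h j)
          (j₀ := j₀) (by simpa using h0 j₀ hj₀))
      obtain ⟨s, hs, heval⟩ := exists_eval_genCross_eq_sum_sign hc h0 ⟨j₀, hj₀⟩
      obtain ⟨a, ha⟩ := hpos
      obtain ⟨b, hb⟩ := hneg
      rw [heval, sum_sign_filter_eq_zero hs h0 ⟨a, hmem a ha.ne', ha⟩ ⟨b, hmem b hb.ne, hb⟩,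
        zero_mul]
    · exact (hzero h0).2
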